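/- Let $n\ge 0$ be an integer. A map $f:\mathbf{C}\to\mathbf{P}^n$ into complex projective space is a holomorphic curve if near every point it has a reduced homogeneous representation, that is, $f=(f_0:\dots:f_n)$ with functions $f_j$ that are holomorphic there and have no common zeros. Its spherical derivative $f^\#\ge 0$ is defined by $$(f^\#)^2=\frac{\sum_{i<j}|f_i'f_j-f_if_j'|^2}{\left(|f_0|^2+\dots+|f_n|^2\right)^2},$$ which does not depend on the representation. For a real number $L$, let $\mathfrak{Y}_n(L)$ be the set of normal curves with $\sup_{z\in\mathbf{C}} f^\#(z)\le L$, where a holomorphic curve $f:\mathbf{C}\to\mathbf{P}^n$ is called normal if $f^\#$ is bounded on $\mathbf{C}$. For $K>0$, a set $E\subset\mathbf{C}$ is called $K$-dense if every closed square in $\mathbf{C}$ with side length $K$ (of any position and orientation) contains at least one point of $E$. Let $K>0$, let $c<\sqrt{\pi/2}$ be a real number, let $E\subset\mathbf{C}$ be $K$-dense, and let $g_0,g_1\in\mathfrak{Y}_n(c/K)$. If $g_0(z)=g_1(z)$ for all $z\in E$, then $g_0=g_1$ on $\mathbf{C}$. -/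

import Mathlib

open scoped LinearAlgebra.Projectivization Topology

/-- Complex projective space of dimension `n`: the lines through `0` in `ℂ^(n+1)`. -/
abbrev CPn (n : ℕ) : Type := ℙ ℂ (EuclideanSpace ℂ (Fin (n + 1)))

/-- `F` is a reduced homogeneous representation of `f` near `z`: its coordinates are holomorphic
near `z` without common zeros, and `f` is the composition of `F` with the projection of
`ℂ^(n+1) \ {0}` onto projective space. -/
def IsReducedRepAt {n : ℕ} (f : ℂ → CPn n) (F : ℂ → EuclideanSpace ℂ (Fin (n + 1))) (z : ℂ) :
    Prop :=
  AnalyticAt ℂ F z ∧ ∀ᶠ w in 𝓝 z, ∃ h : F w ≠ 0, f w = Projectivization.mk ℂ (F w) h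

/-- Holomorphic curves `ℂ → ℙⁿ`. Holomorphy is a local condition: near every point the map lifts
to a holomorphic map into `ℂ^(n+1) \ {0}`. -/
def IsHolomorphicCurve {n : ℕ} (f : ℂ → CPn n) : Prop :=
  ∀ z, ∃ F, IsReducedRepAt f F z

/-- The expression `√(∑_{i<j} |F_i' F_j - F_i F_j'|²) / ‖F‖²` at the point `z`. -/
noncomputable def repSphericalDeriv {n : ℕ} (F : ℂ → EuclideanSpace ℂ (Fin (n + 1))) (z : ℂ) : ℝ :=
  Real.sqrt (∑ i, ∑ j ∈ Finset.Ioi i, ‖deriv F z i * F z j - F z i * deriv F z j‖ ^ 2) /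
    ‖F z‖ ^ 2

open Classical in
/-- The spherical derivative `f^#` (with respect to the Fubini-Study metric), computed from any
reduced homogeneous representation of `f` near `z`; see `sphericalDeriv_eq` for the independence
of the choice. -/
noncomputable def sphericalDeriv {n : ℕ} (f : ℂ → CPn n) (z : ℂ) : ℝ :=
  if h : ∃ F, IsReducedRepAt f F z then repSphericalDeriv h.choose z else 0

theorem repSphericalDeriv_congr {n : ℕ} {f : ℂ → CPn n}
    {F G : ℂ → EuclideanSpace ℂ (Fin (n + 1))} {z : ℂ}
    (hF : IsReducedRepAt f F z) (hG : IsReducedRepAt f G z) :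
    repSphericalDeriv G z = repSphericalDeriv F z := by
  obtain ⟨hFa, hFe⟩ := hF
  obtain ⟨hGa, hGe⟩ := hG
  obtain ⟨hFz, -⟩ := hFe.self_of_nhds
  obtain ⟨hGz, -⟩ := hGe.self_of_nhds
  have hk : ∃ k, F z k ≠ 0 := by
    by_contra! h
    exact hFz (by ext k; simpa using h k)
  obtain ⟨k, hk⟩ := hk
  have coordF : ∀ i, HasDerivAt (fun w => F w i) (deriv F z i) z := fun i =>
    (EuclideanSpace.proj (𝕜 := ℂ) i).hasFDerivAt.comp_hasDerivAt z
      hFa.differentiableAt.hasDerivAt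
  have coordG : ∀ i, HasDerivAt (fun w => G w i) (deriv G z i) z := fun i =>
    (EuclideanSpace.proj (𝕜 := ℂ) i).hasFDerivAt.comp_hasDerivAt z
      hGa.differentiableAt.hasDerivAt
  have hFk : ∀ᶠ w in 𝓝 z, F w k ≠ 0 := (coordF k).continuousAt.eventually_ne hk
  have hprop : ∀ᶠ w in 𝓝 z, G w = (G w k / F w k) • F w := by
    filter_upwards [hFe, hGe, hFk] with w ⟨h1, e1⟩ ⟨h2, e2⟩ h3
    have he := e2.symm.trans e1
    rw [Projectivization.mk_eq_mk_iff'] at he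
    obtain ⟨a, ha⟩ := he
    rw [← ha]
    simp [h3]
  set u : ℂ → ℂ := fun w => G w k / F w k with hu
  obtain ⟨u', hu'⟩ : ∃ u', HasDerivAt u u' z := ⟨_, (coordG k).div (coordF k) hk⟩
  have hGzu : G z = u z • F z := hprop.self_of_nhds
  have hdG : deriv G z = u z • deriv F z + u' • F z :=
    ((hu'.smul hFa.differentiableAt.hasDerivAt).congr_of_eventuallyEq hprop).deriv
  have huz : u z ≠ 0 := by
    intro h
    apply hGz
    rw [hGzu, h, zero_smul]
  have hterm : ∀ i j, ‖deriv G z i * G z j - G z i * deriv G z j‖ ^ 2 =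
      (‖u z‖ ^ 2) ^ 2 * ‖deriv F z i * F z j - F z i * deriv F z j‖ ^ 2 := by
    intro i j
    rw [hdG, hGzu, ← mul_pow, ← norm_pow (u z), ← norm_mul]
    congr 2
    simp only [PiLp.add_apply, PiLp.smul_apply, smul_eq_mul]
    ring
  unfold repSphericalDeriv
  simp only [hterm, ← Finset.mul_sum]
  rw [Real.sqrt_mul (by positivity), Real.sqrt_sq (by positivity), hGzu, norm_smul, mul_pow,
    mul_div_mul_left _ _ (by positivity)]

theorem sphericalDeriv_eq {n : ℕ} {f : ℂ → CPn n}
    {F : ℂ → EuclideanSpace ℂ (Fin (n + 1))} {z : ℂ} (hF : IsReducedRepAt f F z) :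
    sphericalDeriv f z = repSphericalDeriv F z := by
  have h : ∃ F, IsReducedRepAt f F z := ⟨F, hF⟩
  rw [sphericalDeriv, dif_pos h]
  exact repSphericalDeriv_congr hF h.choose_spec

/-- Normal curves `ℂ → ℙⁿ`: holomorphic curves with bounded spherical derivative. -/
def normalCurves (n : ℕ) : Set (ℂ → CPn n) :=
  {f | IsHolomorphicCurve f ∧ BddAbove (Set.range (sphericalDeriv f))}

/-- Normal curves `f : ℂ → ℙⁿ` with `sup f^# ≤ L`. -/
def normalCurvesBound (n : ℕ) (L : ℝ) : Set (ℂ → CPn n) :=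
  {f | f ∈ normalCurves n ∧ (⨆ z, sphericalDeriv f z) ≤ L}

/-- The closed square with side length `K`, a vertex at `a`, and sides in the directions of the
orthogonal unit vectors `u` and `u * I`. -/
def closedSquare (a : ℂ) (u : Circle) (K : ℝ) : Set ℂ :=
  {z | ∃ s ∈ Set.Icc (0 : ℝ) K, ∃ t ∈ Set.Icc (0 : ℝ) K, z = a + u * (s + t * Complex.I)}

/-- `E` is `K`-dense if every square with side length `K` contains a point of `E`. -/
def IsKDense (K : ℝ) (E : Set ℂ) : Prop :=
  ∀ (a : ℂ) (u : Circle), (closedSquare a u K ∩ E).Nonempty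

open Asymptotics Complex Filter Metric

/-! For local lifts `F`, `G` of the two curves and indices `i`, `j`, let `d = |F_i G_j - F_j G_i| /
(‖F‖ ‖G‖)`. This function is bounded, and the curves coincide once all these minors vanish
identically. Since `Δ log ‖F‖ = 2 (f^#)²`, away from its zeros `log d` has Laplacian at least `-4 A`
whenever `A` bounds both squared spherical derivatives.

Suppose `d 0 > 0`. Jensen's formula on the disc of radius `R` bounds `∑ log (R / |a|)`, taken over
zeros `a` of `d`, by `A R² + O(1)`. A `K`-dense zero set has about `π t² / K²` points in the disc of
radius `t`, so it makes this sum at least about `π R² / (2 K²)`. The hypothesis on `c` says exactly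
that `(c / K)² < π / (2 K²)`, which leaves room for `A`; a large `R` gives a contradiction.
Translation handles the other points.

No Laplacian and no circle means are computed. The differential inequality becomes local support
from below by holomorphic functions (`IsLogSupported`, proved for minors in
`isLogSupported_normalizedMinor`), and Jensen's inequality becomes a maximum principle after
dividing out zeros by Blaschke factors (`pow_mul_prod_canonicalFactor_le`). The zeros are counted in
`IsKDense.exists_finset_le_sum_log`. -/

/-! ### Maximum principle and a Jensen-type inequality. -/

/-- A nonnegative function `d` on the plane is logarithmically supported with constant `A` if near
each point `z₀` with `d z₀ > 0` it is bounded from below by `‖h z‖ * exp (-A * ‖z - z₀‖ ^ 2)`, where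
`h` is holomorphic, with equality at `z₀`. This is a form of the inequality
`Δ (log d) ≥ -4 * A` that needs no derivatives. -/
def IsLogSupported (A : ℝ) (d : ℂ → ℝ) : Prop :=
  ∀ z₀, 0 < d z₀ → ∃ h : ℂ → ℂ, AnalyticAt ℂ h z₀ ∧ ‖h z₀‖ = d z₀ ∧
    ∀ᶠ z in 𝓝 z₀, ‖h z‖ * Real.exp (-A * ‖z - z₀‖ ^ 2) ≤ d z

/-- At a local maximum of `u`, `|G|` would also have one, so `G` would be locally constant; the
Gaussian factor then pushes `u` strictly above `u z₀` at nearby points. -/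
theorem not_isLocalMax_of_analyticAt_support {u : ℂ → ℝ} {G : ℂ → ℂ} {z₀ : ℂ} {κ : ℝ} (hκ : 0 < κ)
    (hG : AnalyticAt ℂ G z₀) (hz₀ : ‖G z₀‖ = u z₀) (hu : 0 < u z₀)
    (hle : ∀ᶠ z in 𝓝 z₀, ‖G z‖ * Real.exp (κ * ‖z - z₀‖ ^ 2) ≤ u z) : ¬ IsLocalMax u z₀ := by
  intro hmax
  have hmaxG : IsLocalMax (norm ∘ G) z₀ := by
    filter_upwards [hle, hmax] with z h1 h2
    have h3 : (1 : ℝ) ≤ Real.exp (κ * ‖z - z₀‖ ^ 2) := Real.one_le_exp (by positivity)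
    have := le_mul_of_one_le_right (norm_nonneg (G z)) h3
    simp only [Function.comp_apply]
    linarith
  have hdiff : ∀ᶠ z in 𝓝 z₀, DifferentiableAt ℂ G z :=
    hG.eventually_analyticAt.mono fun z hz => hz.differentiableAt
  have hconst := eventually_eq_of_isLocalMax_norm hdiff hmaxG
  have hall : ∀ᶠ z in 𝓝[≠] z₀, z ≠ z₀ ∧ G z = G z₀ ∧
      ‖G z‖ * Real.exp (κ * ‖z - z₀‖ ^ 2) ≤ u z ∧ u z ≤ u z₀ := by
    filter_upwards [self_mem_nhdsWithin, nhdsWithin_le_nhds hconst, nhdsWithin_le_nhds hle,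
      nhdsWithin_le_nhds hmax] with z h0 h1 h2 h3 using ⟨h0, h1, h2, h3⟩
  obtain ⟨z, hne, h1, h2, h3⟩ := hall.exists
  have hpos : 0 < ‖z - z₀‖ := norm_pos_iff.mpr (sub_ne_zero.mpr hne)
  have h4 : (1 : ℝ) < Real.exp (κ * ‖z - z₀‖ ^ 2) := Real.one_lt_exp_iff.mpr (by positivity)
  rw [h1, hz₀] at h2
  have := lt_mul_of_one_lt_right hu h4
  linarith

theorem analyticAt_prod_canonicalFactor {R : ℝ} {S : Finset ℂ} {z : ℂ} (hz : z ∉ S) :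
    AnalyticAt ℂ (fun w => ∏ a ∈ S, canonicalFactor R a w) z := by
  refine Finset.analyticAt_fun_prod _ fun a ha => analyticOnNhd_canonicalFactor R a z ?_
  rintro rfl
  exact hz ha

theorem isBigO_canonicalFactor_mul_self (R : ℝ) (a : ℂ) :
    (fun z => canonicalFactor R a z * (z - a)) =O[𝓝 a] (fun _ => (1 : ℝ)) := by
  have h1 : (fun z : ℂ => (R ^ 2 - (starRingEnd ℂ) a * z) / R) =O[𝓝 a] (fun _ => (1 : ℝ)) := by
    have hc : ContinuousAt (fun z : ℂ => (R ^ 2 - (starRingEnd ℂ) a * z) / R) a := by fun_prop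
    exact hc.tendsto.isBigO_one ℝ
  refine IsBigO.trans (IsBigO.of_bound 1 (Eventually.of_forall fun z => ?_)) h1
  rw [one_mul, canonicalFactor_apply]
  rcases eq_or_ne z a with rfl | hza
  · simpa using by positivity
  · apply le_of_eq
    congr 1
    have := sub_ne_zero.mpr hza
    rw [div_mul_eq_mul_div, mul_div_mul_right _ _ this]

theorem isBigO_mul_norm_prod_canonicalFactor {R : ℝ} {S : Finset ℂ} {a : ℂ} (ha : a ∈ S)
    {d : ℂ → ℝ} (hd : d =O[𝓝 a] fun z => z - a) :
    (fun z => d z * ‖∏ b ∈ S, canonicalFactor R b z‖) =O[𝓝 a] (fun _ => (1 : ℝ)) := by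
  have h1 : (fun z => ∏ b ∈ S.erase a, canonicalFactor R b z) =O[𝓝 a] (fun _ => (1 : ℝ)) :=
    ((analyticAt_prod_canonicalFactor (Finset.notMem_erase a S)).continuousAt.tendsto).isBigO_one ℝ
  have h3 : (fun z => d z * ‖canonicalFactor R a z‖) =O[𝓝 a] (fun _ => (1 : ℝ)) := by
    refine (IsBigO.of_norm_left ?_)
    refine IsBigO.trans ?_ (isBigO_canonicalFactor_mul_self R a)
    have h4 : (fun z => d z * ‖canonicalFactor R a z‖) =O[𝓝 a]
        fun z => canonicalFactor R a z * (z - a) := by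
      have := hd.norm_right.mul (isBigO_refl (fun z => ‖canonicalFactor R a z‖) (𝓝 a))
      refine this.trans (IsBigO.of_bound 1 (Eventually.of_forall fun z => ?_))
      simp [mul_comm]
    exact h4.norm_left
  have h5 := h3.mul h1.norm_left
  simp only [mul_one] at h5
  refine h5.congr_left fun z => ?_
  rw [← Finset.mul_prod_erase S _ ha, norm_mul, mul_assoc]

/-- At a point of `S` the pole only meets a zero of `d`, so `d * ‖∏ …‖` is bounded there but need
not be continuous. The spare factor `d` forces the limit `0`, which is also the value. -/
theorem continuous_pow_mul_canonicalFactor {R : ℝ} {S : Finset ℂ}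
    {d : ℂ → ℝ} (hd : Continuous d) (hS : ∀ a ∈ S, d =O[𝓝 a] fun z => z - a) (N : ℕ) :
    Continuous fun z => d z * (d z * ‖∏ a ∈ S, canonicalFactor R a z‖) ^ N := by
  rw [continuous_iff_continuousAt]
  intro z
  by_cases hz : z ∈ S
  · have hdz : d z = 0 := (hS z hz).eq_zero_imp.self_of_nhds (sub_self z)
    have h1 := (isBigO_mul_norm_prod_canonicalFactor (R := R) hz (hS z hz)).pow N
    have h2 : Tendsto d (𝓝 z) (𝓝 0) := by simpa [hdz] using hd.tendsto z
    have h3 : d =o[𝓝 z] (fun _ => (1 : ℝ)) := (isLittleO_one_iff ℝ).mpr h2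
    have h4 := h3.mul_isBigO h1
    simp only [one_pow, mul_one] at h4
    rw [isLittleO_one_iff] at h4
    rw [ContinuousAt]
    simpa [hdz] using h4
  · have h1 := (analyticAt_prod_canonicalFactor (R := R) hz).continuousAt
    have h2 := hd.continuousAt (x := z)
    exact h2.mul ((h2.mul h1.norm).pow N)

/-- A substitute for Jensen's inequality: the canonical factors are inverse Blaschke factors, with
poles in `S` and modulus one on the circle. The Gaussian compensates the negative Laplacian of `log
d`, so the maximum over the disc is zero or is reached on the circle. The price of the spare factor
`d` is `N + 1` against `N`, negligible for large `N`. -/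
theorem pow_mul_prod_canonicalFactor_le {R M A A' : ℝ} (hR : 0 < R) (hA : A' < A)
    {d : ℂ → ℝ} (hd : Continuous d) (hd0 : ∀ z, 0 ≤ d z) (hdM : ∀ z, d z ≤ M)
    (hsupp : IsLogSupported A' d) {S : Finset ℂ} (hSR : ∀ a ∈ S, a ∈ ball (0 : ℂ) R)
    (hS : ∀ a ∈ S, d =O[𝓝 a] fun z => z - a) (N : ℕ) :
    d 0 * (d 0 * ‖∏ a ∈ S, canonicalFactor R a 0‖) ^ N ≤
      M ^ (N + 1) * Real.exp ((N + 1) * A * R ^ 2) := by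
  set C : ℂ → ℂ := fun z => ∏ a ∈ S, canonicalFactor R a z with hC
  set u : ℂ → ℝ := fun z => d z * (d z * ‖C z‖) ^ N * Real.exp ((N + 1) * A * ‖z‖ ^ 2) with hu
  have hucont : Continuous u :=
    (continuous_pow_mul_canonicalFactor hd hS N).mul (by fun_prop)
  have hu0 : ∀ z, 0 ≤ u z := fun z => by have := hd0 z; positivity
  have hM0 : 0 ≤ M := (hd0 0).trans (hdM 0)
  obtain ⟨z₀, hz₀, hmax⟩ := (isCompact_closedBall (0 : ℂ) R).exists_isMaxOn
    ⟨0, mem_closedBall_self hR.le⟩ hucont.continuousOn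
  have h0 : u 0 ≤ u z₀ := hmax (mem_closedBall_self hR.le)
  have hu00 : u 0 = d 0 * (d 0 * ‖C 0‖) ^ N := by simp [hu]
  rw [← hu00]
  refine h0.trans ?_
  rcases (hu0 z₀).eq_or_lt with huz | huz
  · rw [← huz]; positivity
  have hdz : 0 < d z₀ := by
    refine lt_of_le_of_ne (hd0 z₀) fun h => huz.ne' ?_
    simp [hu, ← h]
  have hz₀S : z₀ ∉ S := fun h => hdz.ne' ((hS z₀ h).eq_zero_imp.self_of_nhds (sub_self z₀))
  rcases (mem_closedBall_zero_iff.mp hz₀).lt_or_eq with hlt | heq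
  · exfalso
    obtain ⟨h, hh, hhz, hhle⟩ := hsupp z₀ hdz
    have hloc : IsLocalMax u z₀ :=
      hmax.isLocalMax (closedBall_mem_nhds_of_mem (mem_ball_zero_iff.mpr hlt))
    have hCan : AnalyticAt ℂ C z₀ := analyticAt_prod_canonicalFactor hz₀S
    -- The exponent is holomorphic with real part a multiple of `‖z‖ ^ 2 - ‖z - z₀‖ ^ 2`; the
    -- remaining `‖z - z₀‖ ^ 2` supplies the strict gain `A - A'`.
    set G : ℂ → ℂ := fun z => h z * (h z * C z) ^ N *
      exp ((N + 1) * A * (‖z₀‖ ^ 2 + 2 * ((starRingEnd ℂ) z₀ * (z - z₀)))) with hG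
    have hGan : AnalyticAt ℂ G z₀ := by
      have : AnalyticAt ℂ (fun z : ℂ =>
        ((N : ℂ) + 1) * A * (‖z₀‖ ^ 2 + 2 * ((starRingEnd ℂ) z₀ * (z - z₀)))) z₀ := by fun_prop
      exact (hh.mul ((hh.mul hCan).pow N)).mul this.cexp
    have hnorm : ∀ z, ‖G z‖ = ‖h z‖ * (‖h z‖ * ‖C z‖) ^ N *
        Real.exp ((N + 1) * A * (‖z‖ ^ 2 - ‖z - z₀‖ ^ 2)) := by
      intro z
      have hre : (((N : ℂ) + 1) * A * (‖z₀‖ ^ 2 + 2 * ((starRingEnd ℂ) z₀ * (z - z₀)))).re =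
          (N + 1) * A * (‖z‖ ^ 2 - ‖z - z₀‖ ^ 2) := by
        have e1 : (((N : ℂ) + 1) * A * (‖z₀‖ ^ 2 + 2 * ((starRingEnd ℂ) z₀ * (z - z₀)))) =
            (((N + 1) * A : ℝ) : ℂ) *
              (((‖z₀‖ ^ 2 : ℝ) : ℂ) + ((2 : ℝ) : ℂ) * ((starRingEnd ℂ) z₀ * (z - z₀))) := by
          push_cast; ring
        rw [e1, re_ofReal_mul, add_re, ofReal_re, re_ofReal_mul, ← normSq_eq_norm_sq,
          ← normSq_eq_norm_sq, ← normSq_eq_norm_sq]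
        simp only [normSq_apply, mul_re, conj_re, conj_im, sub_re, sub_im]
        ring
      rw [hG]
      simp only [norm_mul, norm_pow, norm_exp, hre]
    refine not_isLocalMax_of_analyticAt_support (κ := (N + 1) * (A - A')) ?_ hGan ?_ huz ?_ hloc
    · have := sub_pos.mpr hA; positivity
    · rw [hnorm, hu]; simp [hhz]
    · filter_upwards [hhle] with z hz
      rw [hnorm, hu]
      have hexp : Real.exp ((N + 1) * A * (‖z‖ ^ 2 - ‖z - z₀‖ ^ 2)) *
          Real.exp ((N + 1) * (A - A') * ‖z - z₀‖ ^ 2) =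
          Real.exp (-A' * ‖z - z₀‖ ^ 2) ^ (N + 1) * Real.exp ((N + 1) * A * ‖z‖ ^ 2) := by
        rw [← Real.exp_nat_mul, ← Real.exp_add, ← Real.exp_add]
        push_cast; ring_nf
      rw [mul_assoc, hexp]
      calc ‖h z‖ * (‖h z‖ * ‖C z‖) ^ N *
            (Real.exp (-A' * ‖z - z₀‖ ^ 2) ^ (N + 1) * Real.exp ((N + 1) * A * ‖z‖ ^ 2))
          = (‖h z‖ * Real.exp (-A' * ‖z - z₀‖ ^ 2)) *
            ((‖h z‖ * Real.exp (-A' * ‖z - z₀‖ ^ 2)) * ‖C z‖) ^ N *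
              Real.exp ((N + 1) * A * ‖z‖ ^ 2) := by ring
        _ ≤ d z * (d z * ‖C z‖) ^ N * Real.exp ((N + 1) * A * ‖z‖ ^ 2) := by
          have := hd0 z; gcongr
  · have hC1 : ‖C z₀‖ = 1 := by
      rw [hC]
      simp only [norm_prod]
      exact Finset.prod_eq_one fun a ha =>
        norm_canonicalFactor_eval_circle_eq_one (hSR a ha) (mem_sphere_zero_iff_norm.mpr heq)
    simp only [hu, hC1, heq, mul_one]
    rw [← pow_succ']
    gcongr
    exact hdM z₀

/-! ### Lagrange's identity and the growth of holomorphic lifts. -/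

theorem two_mul_sum_sum_Ioi {m : ℕ} {g : Fin m → Fin m → ℝ} (hsymm : ∀ i j, g i j = g j i)
    (hdiag : ∀ i, g i i = 0) : 2 * ∑ i, ∑ j ∈ Finset.Ioi i, g i j = ∑ i, ∑ j, g i j := by
  have h1 : ∑ i, ∑ j ∈ Finset.Iio i, g i j = ∑ i, ∑ j ∈ Finset.Ioi i, g i j := by
    rw [Finset.sum_comm' (t' := Finset.univ) (s' := fun j => Finset.Ioi j) (by simp)]
    simp only [hsymm]
  have h2 : ∀ i, ∑ j, g i j = ∑ j ∈ Finset.Ioi i, g i j + ∑ j ∈ Finset.Iio i, g i j := by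
    intro i
    rw [← Finset.sum_filter_add_sum_filter_not Finset.univ (fun j => i < j)]
    congr 1
    · exact Finset.sum_congr (by ext; simp) fun _ _ => rfl
    · symm
      refine Finset.sum_subset (fun j hj => ?_) fun j hj hj' => ?_
      · simpa using (Finset.mem_Iio.mp hj).le
      · obtain rfl : j = i := by
          simp only [Finset.mem_filter, Finset.mem_univ, true_and, not_lt, Finset.mem_Iio] at hj hj'
          exact le_antisymm hj hj'
        exact hdiag j
  simp only [h2, Finset.sum_add_distrib, h1]
  ring

/-- Lagrange's identity. -/
theorem sum_norm_sq_sub_mul_eq {m : ℕ} (v w : EuclideanSpace ℂ (Fin m)) :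
    ∑ i, ∑ j ∈ Finset.Ioi i, ‖w i * v j - v i * w j‖ ^ 2 =
      ‖v‖ ^ 2 * ‖w‖ ^ 2 - ‖inner ℂ v w‖ ^ 2 := by
  have h := two_mul_sum_sum_Ioi (g := fun i j => ‖w i * v j - v i * w j‖ ^ 2)
    (fun i j => by rw [norm_sub_rev]; ring_nf) (fun i => by simp [mul_comm])
  suffices hs : ∑ i, ∑ j, ‖w i * v j - v i * w j‖ ^ 2 =
      2 * (‖v‖ ^ 2 * ‖w‖ ^ 2 - ‖inner ℂ v w‖ ^ 2) by linarith
  have key : ∀ x : ℂ, ((‖x‖ ^ 2 : ℝ) : ℂ) = x * (starRingEnd ℂ) x := fun x => by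
    rw [mul_conj, normSq_eq_norm_sq]
  apply ofReal_injective
  rw [EuclideanSpace.norm_sq_eq, EuclideanSpace.norm_sq_eq, PiLp.inner_apply]
  push_cast [← ofReal_pow, key]
  simp only [map_sub, map_mul, map_sum, RCLike.inner_apply, conj_conj, Finset.sum_mul_sum,
    ← Finset.sum_sub_distrib]
  simp only [Finset.mul_sum]
  -- The two double sums agree only after symmetrizing in `i` and `j`; then they agree term by term.
  have e : ∀ p : Fin m → Fin m → ℂ, ∑ i, ∑ j, p i j = ∑ i, ∑ j, (p i j + p j i) / 2 := by
    intro p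
    simp only [← Finset.sum_div, Finset.sum_add_distrib]
    rw [Finset.sum_comm (f := fun i j => p j i)]
    ring
  refine (e _).trans (Eq.trans ?_ (e _).symm)
  refine Finset.sum_congr rfl fun i _ => Finset.sum_congr rfl fun j _ => ?_
  ring

theorem analyticAt_apply {m : ℕ} {F : ℂ → EuclideanSpace ℂ (Fin m)} {z : ℂ}
    (hF : AnalyticAt ℂ F z) (i : Fin m) : AnalyticAt ℂ (fun w => F w i) z :=
  ((EuclideanSpace.proj (𝕜 := ℂ) i).analyticAt _).comp hF

/-- A holomorphic lift is bounded near `z₀` by a holomorphic scalar function times a Gaussian factor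
whose exponent is governed by the spherical derivative. -/
theorem exists_analyticAt_norm_le_of_repSphericalDeriv {n : ℕ}
    {F : ℂ → EuclideanSpace ℂ (Fin (n + 1))} {z₀ : ℂ} (hF : AnalyticAt ℂ F z₀) (hF0 : F z₀ ≠ 0)
    {A : ℝ} (hA : repSphericalDeriv F z₀ ^ 2 < A) :
    ∃ g : ℂ → ℂ, AnalyticAt ℂ g z₀ ∧ ‖g z₀‖ = ‖F z₀‖ ∧
      ∀ᶠ z in 𝓝 z₀, ‖F z‖ ≤ ‖g z‖ * Real.exp (A / 2 * ‖z - z₀‖ ^ 2) := by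
  set a := F z₀ with ha
  have hapos : 0 < ‖a‖ := norm_pos_iff.mpr hF0
  have hinner : AnalyticAt ℂ (fun z => inner ℂ a (F z)) z₀ :=
    ((innerSL ℂ a).analyticAt _).comp hF
  refine ⟨fun z => inner ℂ a (F z) / ‖a‖, hinner.div_const, ?_, ?_⟩
  · rw [norm_div, ← ha, inner_self_eq_norm_sq_to_K]
    simp
    field_simp
  -- By Lagrange's identity `Q` is the part of `‖F‖²` missed by the projection to `a`, scaled by
  -- `‖a‖²`. Its second-order coefficient at `z₀` is `(f^#)² ‖a‖⁴`.
  set Q : ℂ → ℝ := fun z => ∑ i, ∑ j ∈ Finset.Ioi i, ‖F z i * a j - a i * F z j‖ ^ 2 with hQ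
  have hQid : ∀ z, ‖a‖ ^ 2 * ‖F z‖ ^ 2 = ‖inner ℂ a (F z)‖ ^ 2 + Q z := fun z => by
    rw [hQ]; simp only [sum_norm_sq_sub_mul_eq]; ring
  have hder : ∀ i, HasDerivAt (fun w => F w i) (deriv F z₀ i) z₀ := fun i =>
    (EuclideanSpace.proj (𝕜 := ℂ) i).hasFDerivAt.comp_hasDerivAt z₀
      hF.differentiableAt.hasDerivAt
  have hlim : Tendsto (fun z => Q z / ‖z - z₀‖ ^ 2) (𝓝[≠] z₀)
      (𝓝 (∑ i, ∑ j ∈ Finset.Ioi i, ‖deriv F z₀ i * a j - a i * deriv F z₀ j‖ ^ 2)) := by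
    have hterm : ∀ i j, Tendsto (fun z => ‖F z i * a j - a i * F z j‖ ^ 2 / ‖z - z₀‖ ^ 2) (𝓝[≠] z₀)
        (𝓝 (‖deriv F z₀ i * a j - a i * deriv F z₀ j‖ ^ 2)) := by
      intro i j
      have h1 := ((hder i).mul_const (a j)).sub ((hder j).const_mul (a i))
      have h2 := (hasDerivAt_iff_tendsto_slope.mp h1).norm.pow 2
      refine h2.congr fun z => ?_
      have h3 : a i * a j - a i * a j = 0 := sub_self _
      rw [slope_def_field, norm_div, div_pow]
      simp only [← ha, Pi.sub_apply, h3, sub_zero]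
    simp only [hQ, Finset.sum_div]
    exact tendsto_finsetSum _ fun i _ => tendsto_finsetSum _ fun j _ => hterm i j
  have hrep : ∑ i, ∑ j ∈ Finset.Ioi i, ‖deriv F z₀ i * a j - a i * deriv F z₀ j‖ ^ 2 =
      repSphericalDeriv F z₀ ^ 2 * ‖a‖ ^ 4 := by
    rw [repSphericalDeriv, div_pow, Real.sq_sqrt (by positivity), ← ha]
    field_simp
  have hlimA : Tendsto (fun z => A * ‖inner ℂ a (F z)‖ ^ 2) (𝓝[≠] z₀) (𝓝 (A * ‖a‖ ^ 4)) := by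
    have h1 : ContinuousAt (fun z => A * ‖inner ℂ a (F z)‖ ^ 2) z₀ :=
      continuousAt_const.mul (hinner.continuousAt.norm.pow 2)
    have h2 : A * ‖inner ℂ a (F z₀)‖ ^ 2 = A * ‖a‖ ^ 4 := by
      rw [← ha, inner_self_eq_norm_sq_to_K]
      simp
      ring_nf
      simp
    rw [← h2]
    exact h1.tendsto.mono_left nhdsWithin_le_nhds
  rw [hrep] at hlim
  have hlt : repSphericalDeriv F z₀ ^ 2 * ‖a‖ ^ 4 < A * ‖a‖ ^ 4 := by gcongr
  have hev := hlim.eventually_lt hlimA hlt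
  have hev' : ∀ᶠ z in 𝓝 z₀, Q z ≤ A * ‖inner ℂ a (F z)‖ ^ 2 * ‖z - z₀‖ ^ 2 := by
    rw [eventually_nhdsWithin_iff] at hev
    filter_upwards [hev] with z hz
    rcases eq_or_ne z z₀ with rfl | hne
    · simp [hQ, ← ha, mul_comm]
    · have hpos : 0 < ‖z - z₀‖ := norm_pos_iff.mpr (sub_ne_zero.mpr hne)
      exact ((div_lt_iff₀ (by positivity)).mp (hz hne)).le
  filter_upwards [hev'] with z hz
  rw [norm_div, norm_real, norm_norm]
  refine le_of_sq_le_sq ?_ (by positivity)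
  -- So far `‖F‖² ≤ ‖g‖² (1 + A ‖z - z₀‖²)`; the exponential absorbs the bracket.
  have h1 := Real.add_one_le_exp (A * ‖z - z₀‖ ^ 2)
  have h2 : Real.exp (A / 2 * ‖z - z₀‖ ^ 2) ^ 2 = Real.exp (A * ‖z - z₀‖ ^ 2) := by
    rw [← Real.exp_nat_mul]; push_cast; ring_nf
  rw [mul_pow, h2, div_pow, div_mul_eq_mul_div, le_div_iff₀ (by positivity), mul_comm, hQid]
  nlinarith [mul_le_mul_of_nonneg_left h1 (sq_nonneg ‖inner ℂ a (F z)‖)]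

/-! ### Normalized minors of two curves. -/

/-- The absolute value of the `(i, j)` minor of a pair of points of projective space, divided by
the norms of the homogeneous coordinates. -/
noncomputable def normalizedMinor {n : ℕ} (i j : Fin (n + 1)) (p q : CPn n) : ℝ :=
  ‖p.rep i * q.rep j - p.rep j * q.rep i‖ / (‖p.rep‖ * ‖q.rep‖)

section normalizedMinor

variable {n : ℕ} {i j : Fin (n + 1)}

theorem normalizedMinor_mk {v w : EuclideanSpace ℂ (Fin (n + 1))} (hv : v ≠ 0) (hw : w ≠ 0) :
    normalizedMinor i j (Projectivization.mk ℂ v hv) (Projectivization.mk ℂ w hw) =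
      ‖v i * w j - v j * w i‖ / (‖v‖ * ‖w‖) := by
  obtain ⟨α, hα⟩ := Projectivization.exists_smul_eq_mk_rep ℂ v hv
  obtain ⟨β, hβ⟩ := Projectivization.exists_smul_eq_mk_rep ℂ w hw
  have hα0 : 0 < ‖(α : ℂ)‖ := norm_pos_iff.mpr α.ne_zero
  have hβ0 : 0 < ‖(β : ℂ)‖ := norm_pos_iff.mpr β.ne_zero
  rw [normalizedMinor, ← hα, ← hβ]
  simp only [Units.smul_def, PiLp.smul_apply, smul_eq_mul, norm_smul]
  have : (α : ℂ) * v i * (β * w j) - α * v j * (β * w i) = α * β * (v i * w j - v j * w i) := by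
    ring
  rw [this, norm_mul, norm_mul, mul_mul_mul_comm, mul_div_mul_left _ _ (by positivity)]

theorem normalizedMinor_nonneg (p q : CPn n) : 0 ≤ normalizedMinor i j p q := by
  unfold normalizedMinor; positivity

theorem normalizedMinor_self (p : CPn n) : normalizedMinor i j p p = 0 := by
  simp [normalizedMinor, mul_comm]

theorem normalizedMinor_le (p q : CPn n) : normalizedMinor i j p q ≤ 2 := by
  refine div_le_of_le_mul₀ (by positivity) (by norm_num) ?_
  have h : ∀ k l, ‖p.rep k * q.rep l‖ ≤ ‖p.rep‖ * ‖q.rep‖ := fun k l => by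
    rw [norm_mul]
    exact mul_le_mul (PiLp.norm_apply_le _ _) (PiLp.norm_apply_le _ _) (by positivity)
      (by positivity)
  linarith [norm_sub_le (p.rep i * q.rep j) (p.rep j * q.rep i), h i j, h j i]

theorem eq_of_normalizedMinor_eq_zero {p q : CPn n}
    (h : ∀ i j, normalizedMinor i j p q = 0) : p = q := by
  have hq : q.rep ≠ 0 := q.rep_nonzero
  have hp : p.rep ≠ 0 := p.rep_nonzero
  have hprod : ∀ i j, p.rep i * q.rep j = p.rep j * q.rep i := fun i j => by
    have := h i j
    rw [normalizedMinor, div_eq_zero_iff, norm_eq_zero, sub_eq_zero] at this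
    exact this.resolve_right (by positivity)
  obtain ⟨k, hk⟩ : ∃ k, q.rep k ≠ 0 := by
    by_contra! h0
    exact hq (by ext k; simpa using h0 k)
  rw [← p.mk_rep, ← q.mk_rep, Projectivization.mk_eq_mk_iff']
  refine ⟨p.rep k / q.rep k, ?_⟩
  ext l
  simp only [PiLp.smul_apply, smul_eq_mul]
  rw [div_mul_eq_mul_div, div_eq_iff hk, hprod l k]

variable {f g : ℂ → CPn n} {F G : ℂ → EuclideanSpace ℂ (Fin (n + 1))} {z₀ : ℂ}

theorem normalizedMinor_eventuallyEq (hF : IsReducedRepAt f F z₀) (hG : IsReducedRepAt g G z₀) :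
    (fun z => normalizedMinor i j (f z) (g z)) =ᶠ[𝓝 z₀]
      fun z => ‖F z i * G z j - F z j * G z i‖ / (‖F z‖ * ‖G z‖) := by
  filter_upwards [hF.2, hG.2] with z ⟨h1, e1⟩ ⟨h2, e2⟩
  rw [e1, e2, normalizedMinor_mk]

theorem analyticAt_minor (hF : IsReducedRepAt f F z₀) (hG : IsReducedRepAt g G z₀) :
    AnalyticAt ℂ (fun z => F z i * G z j - F z j * G z i) z₀ :=
  ((analyticAt_apply hF.1 i).mul (analyticAt_apply hG.1 j)).sub
    ((analyticAt_apply hF.1 j).mul (analyticAt_apply hG.1 i))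

theorem IsReducedRepAt.ne_zero (hF : IsReducedRepAt f F z₀) : F z₀ ≠ 0 :=
  hF.2.self_of_nhds.1

theorem continuous_normalizedMinor (hf : IsHolomorphicCurve f) (hg : IsHolomorphicCurve g) :
    Continuous fun z => normalizedMinor i j (f z) (g z) := by
  rw [continuous_iff_continuousAt]
  intro z
  obtain ⟨F, hF⟩ := hf z
  obtain ⟨G, hG⟩ := hg z
  refine ContinuousAt.congr ?_ (normalizedMinor_eventuallyEq hF hG).symm
  have h1 := hF.ne_zero
  have h2 := hG.ne_zero
  exact (analyticAt_minor hF hG).continuousAt.norm.div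
    (hF.1.continuousAt.norm.mul hG.1.continuousAt.norm) (by positivity)

theorem isBigO_normalizedMinor (hf : IsHolomorphicCurve f) (hg : IsHolomorphicCurve g) {a : ℂ}
    (ha : f a = g a) :
    (fun z => normalizedMinor i j (f z) (g z)) =O[𝓝 a] fun z => z - a := by
  obtain ⟨F, hF⟩ := hf a
  obtain ⟨G, hG⟩ := hg a
  refine (normalizedMinor_eventuallyEq hF hG).trans_isBigO ?_
  have h1 := hF.ne_zero
  have h2 := hG.ne_zero
  have h0 : F a i * G a j - F a j * G a i = 0 := by
    have h3 := (normalizedMinor_eventuallyEq (i := i) (j := j) hF hG).self_of_nhds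
    simp only [ha, normalizedMinor_self] at h3
    have h4 := h3.symm
    rw [div_eq_zero_iff, norm_eq_zero] at h4
    exact h4.resolve_right (by positivity)
  have h5 := (analyticAt_minor (i := i) (j := j) hF hG).differentiableAt.isBigO_sub
  simp only [h0, sub_zero] at h5
  have h6 : (fun z => (‖F z‖ * ‖G z‖)⁻¹) =O[𝓝 a] (fun _ => (1 : ℝ)) := by
    have : ContinuousAt (fun z => (‖F z‖ * ‖G z‖)⁻¹) a :=
      (hF.1.continuousAt.norm.mul hG.1.continuousAt.norm).inv₀
        (mul_ne_zero (norm_ne_zero_iff.mpr h1) (norm_ne_zero_iff.mpr h2))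
    exact this.tendsto.isBigO_one ℝ
  have h7 := h5.norm_norm.mul h6
  simp only [mul_one] at h7
  exact h7.of_norm_right

/-- The numerator is already the modulus of a holomorphic function. Replacing each norm in the
denominator by its holomorphic majorant costs a Gaussian with constant `A / 2`, hence `A` for the
two curves. -/
theorem isLogSupported_normalizedMinor (hf : IsHolomorphicCurve f) (hg : IsHolomorphicCurve g)
    {A : ℝ} (hfA : ∀ z, sphericalDeriv f z ^ 2 < A) (hgA : ∀ z, sphericalDeriv g z ^ 2 < A) :
    IsLogSupported A fun z => normalizedMinor i j (f z) (g z) := by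
  intro z₀ hpos
  obtain ⟨F, hF⟩ := hf z₀
  obtain ⟨G, hG⟩ := hg z₀
  have hF0 := norm_pos_iff.mpr hF.ne_zero
  have hG0 := norm_pos_iff.mpr hG.ne_zero
  obtain ⟨φ, hφ, hφ0, hφle⟩ := exists_analyticAt_norm_le_of_repSphericalDeriv hF.1 hF.ne_zero
    (A := A) (by rw [← sphericalDeriv_eq hF]; exact hfA z₀)
  obtain ⟨ψ, hψ, hψ0, hψle⟩ := exists_analyticAt_norm_le_of_repSphericalDeriv hG.1 hG.ne_zero
    (A := A) (by rw [← sphericalDeriv_eq hG]; exact hgA z₀)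
  have hφne : φ z₀ ≠ 0 := norm_pos_iff.mp (hφ0 ▸ hF0)
  have hψne : ψ z₀ ≠ 0 := norm_pos_iff.mp (hψ0 ▸ hG0)
  have heq := normalizedMinor_eventuallyEq (i := i) (j := j) hF hG
  refine ⟨fun z => (F z i * G z j - F z j * G z i) / (φ z * ψ z),
    (analyticAt_minor hF hG).div (hφ.mul hψ) (mul_ne_zero hφne hψne), ?_, ?_⟩
  · rw [heq.self_of_nhds, norm_div, norm_mul, hφ0, hψ0]
  · filter_upwards [heq, hφle, hψle, hφ.continuousAt.eventually_ne hφne,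
      hψ.continuousAt.eventually_ne hψne, hF.2, hG.2] with z h1 h2 h3 h4 h5 ⟨h6, _⟩ ⟨h7, _⟩
    rw [h1, norm_div, norm_mul, neg_mul, Real.exp_neg, ← div_eq_mul_inv, div_div]
    have h8 : 0 < ‖F z‖ := norm_pos_iff.mpr h6
    have h9 : 0 < ‖G z‖ := norm_pos_iff.mpr h7
    refine div_le_div_of_nonneg_left (norm_nonneg _) (by positivity) ?_
    calc ‖F z‖ * ‖G z‖
        ≤ (‖φ z‖ * Real.exp (A / 2 * ‖z - z₀‖ ^ 2)) *
          (‖ψ z‖ * Real.exp (A / 2 * ‖z - z₀‖ ^ 2)) := by gcongr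
      _ = ‖φ z‖ * ‖ψ z‖ * (Real.exp (A / 2 * ‖z - z₀‖ ^ 2) *
          Real.exp (A / 2 * ‖z - z₀‖ ^ 2)) := by ring
      _ = ‖φ z‖ * ‖ψ z‖ * Real.exp (A * ‖z - z₀‖ ^ 2) := by
        rw [← Real.exp_add]; ring_nf

end normalizedMinor

/-! ### Counting points of a dense set in discs. -/

open MeasureTheory in
theorem volume_Icc_reProdIm_Icc {x y s : ℝ} (hs : 0 ≤ s) :
    volume (Set.Icc x (x + s) ×ℂ Set.Icc y (y + s)) = ENNReal.ofReal (s ^ 2) := by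
  have h : Set.Icc x (x + s) ×ℂ Set.Icc y (y + s) =
      measurableEquivRealProd ⁻¹' (Set.Icc x (x + s) ×ˢ Set.Icc y (y + s)) := by
    ext z
    simp [mem_reProdIm, measurableEquivRealProd_apply, and_and_and_comm]
  rw [h, volume_preserving_equiv_real_prod.measure_preimage
    (measurableSet_Icc.prod measurableSet_Icc).nullMeasurableSet, Measure.volume_eq_prod,
    Measure.prod_prod, Real.volume_Icc, Real.volume_Icc, ← ENNReal.ofReal_mul (by linarith)]
  ring_nf

/-- Axis-parallel squares suffice. With spacing `s > K` the closed squares are disjoint, so the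
chosen points are distinct. -/
theorem IsKDense.exists_lattice {K : ℝ} {E : Set ℂ} (hE : IsKDense K E) (s : ℝ) :
    ∃ a : ℤ × ℤ → ℂ, ∀ p, a p ∈ E ∧ (a p).re ∈ Set.Icc (p.1 * s) (p.1 * s + K) ∧
      (a p).im ∈ Set.Icc (p.2 * s) (p.2 * s + K) := by
  have h : ∀ p : ℤ × ℤ, ∃ z : ℂ, z ∈ E ∧ z.re ∈ Set.Icc (p.1 * s) (p.1 * s + K) ∧
      z.im ∈ Set.Icc (p.2 * s) (p.2 * s + K) := by
    intro p
    obtain ⟨z, ⟨x, hx, y, hy, rfl⟩, hzE⟩ := hE ⟨p.1 * s, p.2 * s⟩ 1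
    exact ⟨_, hzE, by simpa using hx, by simpa using hy⟩
  choose a ha using h
  exact ⟨a, ha⟩

section lattice

variable {K s : ℝ} {a : ℤ × ℤ → ℂ}

theorem injective_of_mem_squares (hs : K < s)
    (ha : ∀ p, (a p).re ∈ Set.Icc (p.1 * s) (p.1 * s + K) ∧
      (a p).im ∈ Set.Icc (p.2 * s) (p.2 * s + K)) : Function.Injective a := by
  have key : ∀ (k l : ℤ) (x : ℝ), x ∈ Set.Icc (k * s) (k * s + K) →
      x ∈ Set.Icc (l * s) (l * s + K) → k ≤ l := by
    intro k l x hk hl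
    by_contra! hlt
    have h1 : (l : ℝ) + 1 ≤ k := by exact_mod_cast hlt
    have hs0 : 0 < s := by linarith [hk.1, hk.2]
    nlinarith [hk.1, hl.2]
  intro p q hpq
  have hp := ha p
  have hq := ha q
  rw [hpq] at hp
  exact Prod.ext (le_antisymm (key _ _ _ hp.1 hq.1) (key _ _ _ hq.1 hp.1))
    (le_antisymm (key _ _ _ hp.2 hq.2) (key _ _ _ hq.2 hp.2))

theorem finite_norm_lt_of_mem_squares (hs0 : 0 < s)
    (ha : ∀ p, (a p).re ∈ Set.Icc (p.1 * s) (p.1 * s + K) ∧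
      (a p).im ∈ Set.Icc (p.2 * s) (p.2 * s + K)) (R : ℝ) : {p | ‖a p‖ < R}.Finite := by
  have key : ∀ (k : ℤ) (x : ℝ), x ∈ Set.Icc (k * s) (k * s + K) → |x| < R →
      k ∈ Set.Icc ⌊-(R + K) / s⌋ ⌈R / s⌉ := by
    intro k x hx hxR
    obtain ⟨h1, h2⟩ := abs_lt.mp hxR
    constructor
    · have : -(R + K) / s ≤ k := by rw [div_le_iff₀ hs0]; linarith [hx.2]
      exact_mod_cast (Int.floor_le _).trans this
    · have : (k : ℝ) ≤ R / s := by rw [le_div_iff₀ hs0]; linarith [hx.1]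
      exact_mod_cast this.trans (Int.le_ceil _)
  have hfin := Set.finite_Icc ⌊-(R + K) / s⌋ ⌈R / s⌉
  refine (hfin.prod hfin).subset fun p hp => ?_
  exact ⟨key _ _ (ha p).1 ((abs_re_le_norm _).trans_lt hp),
    key _ _ (ha p).2 ((abs_im_le_norm _).trans_lt hp)⟩

-- Area comparison: the grid cells of side `s` whose points have modulus at most `t` cover the disc
-- of radius `t - 2 * s`.
open MeasureTheory in
theorem pi_mul_sq_le_card_of_mem_squares (hs : K < s) (hs0 : 0 < s)
    (ha : ∀ p, (a p).re ∈ Set.Icc (p.1 * s) (p.1 * s + K) ∧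
      (a p).im ∈ Set.Icc (p.2 * s) (p.2 * s + K)) {P : Finset (ℤ × ℤ)} {t : ℝ}
    (hP : ∀ p, ‖a p‖ ≤ t → p ∈ P) (ht : 2 * s ≤ t) :
    Real.pi * (t - 2 * s) ^ 2 ≤ (P.filter fun p => ‖a p‖ ≤ t).card * s ^ 2 := by
  set C : ℤ × ℤ → Set ℂ := fun p =>
    Set.Icc (p.1 * s) (p.1 * s + s) ×ℂ Set.Icc (p.2 * s) (p.2 * s + s) with hC
  have hcover : ball (0 : ℂ) (t - 2 * s) ⊆ ⋃ p ∈ P.filter (fun p => ‖a p‖ ≤ t), C p := by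
    intro z hz
    rw [mem_ball_zero_iff] at hz
    have hfl : ∀ x : ℝ, x ∈ Set.Icc (⌊x / s⌋ * s) (⌊x / s⌋ * s + s) := by
      intro x
      have h1 := Int.floor_le (x / s)
      have h2 := (Int.lt_floor_add_one (x / s)).le
      rw [le_div_iff₀ hs0] at h1
      rw [div_le_iff₀ hs0] at h2
      exact ⟨h1, by linarith⟩
    set p : ℤ × ℤ := (⌊z.re / s⌋, ⌊z.im / s⌋) with hp
    have h1 : z.re ∈ Set.Icc (p.1 * s) (p.1 * s + s) := hfl z.re
    have h2 : z.im ∈ Set.Icc (p.2 * s) (p.2 * s + s) := hfl z.im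
    obtain ⟨h3, h4⟩ := ha p
    have h5 : |(a p - z).re| ≤ s := by
      rw [sub_re, abs_le]; constructor <;> linarith [h1.1, h1.2, h3.1, h3.2]
    have h6 : |(a p - z).im| ≤ s := by
      rw [sub_im, abs_le]; constructor <;> linarith [h2.1, h2.2, h4.1, h4.2]
    -- The loss `2 * s` bounds the distance from `z` to the point of its cell, as the sum of the two
    -- coordinate differences.
    have h7 : ‖a p‖ ≤ t := by
      have e : a p = (a p - z) + z := by ring
      have h8 := norm_add_le (a p - z) z
      have h9 := norm_le_abs_re_add_abs_im (a p - z)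
      rw [← e] at h8
      linarith
    simp only [Set.mem_iUnion, Finset.mem_filter]
    exact ⟨p, ⟨hP p h7, h7⟩, h1, h2⟩
  have hvol := (measure_mono (μ := volume) hcover).trans (measure_biUnion_finset_le _ _)
  simp only [hC, volume_Icc_reProdIm_Icc hs0.le, Complex.volume_ball, Finset.sum_const,
    nsmul_eq_mul] at hvol
  have e1 : ENNReal.ofReal (t - 2 * s) ^ 2 * (NNReal.pi : ENNReal) =
      ENNReal.ofReal (Real.pi * (t - 2 * s) ^ 2) := by
    rw [mul_comm Real.pi, ENNReal.ofReal_mul (by positivity), ENNReal.ofReal_pow (by linarith),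
      ← NNReal.coe_real_pi, ENNReal.ofReal_coe_nnreal]
  rw [e1, ← ENNReal.ofReal_natCast, ← ENNReal.ofReal_mul (by positivity)] at hvol
  exact (ENNReal.ofReal_le_ofReal_iff (by positivity)).mp hvol

end lattice

open MeasureTheory in
theorem intervalIntegrable_indicator_inv {r R : ℝ} (hr : 0 < r) (hrR : r ≤ R) (x : ℝ) :
    IntervalIntegrable ((Set.Ici x).indicator fun t => t⁻¹) volume r R := by
  have h : IntervalIntegrable (fun t : ℝ => t⁻¹) volume r R := by
    refine intervalIntegral.intervalIntegrable_inv (fun t ht => ?_) continuousOn_id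
    rw [Set.uIcc_of_le hrR] at ht
    exact (hr.trans_le ht.1).ne'
  rw [intervalIntegrable_iff] at h ⊢
  exact h.indicator measurableSet_Ici

-- Only an inequality: when `x < r` the part of the integral between `x` and `r` is dropped.
open MeasureTheory in
theorem integral_indicator_inv_le_log {r R x : ℝ} (hrR : r ≤ R) (hx : 0 < x) (hxR : x ≤ R) :
    ∫ t in r..R, (Set.Ici x).indicator (fun t => t⁻¹) t ≤ Real.log (R / x) := by
  rw [intervalIntegral.integral_of_le hrR, setIntegral_indicator measurableSet_Ici]
  have h0 : (0 : ℝ) ∉ Set.uIcc x R := by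
    rw [Set.uIcc_of_le hxR]; exact fun h => hx.not_ge h.1
  rw [← integral_inv h0, intervalIntegral.integral_of_le hxR, ← integral_Icc_eq_integral_Ioc]
  refine setIntegral_mono_set ?_ ?_ ?_
  · refine (continuousOn_inv₀.mono fun t ht => ?_).integrableOn_Icc
    exact (hx.trans_le ht.1).ne'
  · filter_upwards [ae_restrict_mem measurableSet_Icc] with t ht
    exact inv_nonneg.mpr (hx.le.trans ht.1)
  · exact Eventually.of_forall fun t ht => ⟨ht.2, ht.1.2⟩

/-- In a disc of radius `R`, a `K`-dense set contains points that contribute almost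
`π * R ^ 2 / (2 * K ^ 2)` to the counting function of Jensen's formula. -/
theorem IsKDense.exists_finset_le_sum_log {K s R : ℝ} (hK : 0 < K) (hs : K < s) {E : Set ℂ}
    (hE : IsKDense K E) (h0 : (0 : ℂ) ∉ E) (hR : 2 * s ≤ R) :
    ∃ S : Finset ℂ, (∀ z ∈ S, z ∈ E) ∧ (∀ z ∈ S, z ∈ ball (0 : ℂ) R) ∧
      Real.pi / s ^ 2 * (R ^ 2 / 2 - 4 * s * R) ≤ ∑ z ∈ S, Real.log (R / ‖z‖) := by
  have hs0 : 0 < s := hK.trans hs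
  obtain ⟨a, haE, ha⟩ : ∃ a : ℤ × ℤ → ℂ, (∀ p, a p ∈ E) ∧
      ∀ p : ℤ × ℤ, (a p).re ∈ Set.Icc (p.1 * s) (p.1 * s + K) ∧
        (a p).im ∈ Set.Icc (p.2 * s) (p.2 * s + K) := by
    obtain ⟨a, ha⟩ := hE.exists_lattice s
    exact ⟨a, fun p => (ha p).1, fun p => (ha p).2⟩
  have hfin := finite_norm_lt_of_mem_squares hs0 ha R
  set P := hfin.toFinset with hPdef
  have hP : ∀ p, p ∈ P ↔ ‖a p‖ < R := fun p => by simp [hPdef]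
  refine ⟨P.image a, fun z hz => ?_, fun z hz => ?_, ?_⟩
  · obtain ⟨p, -, rfl⟩ := Finset.mem_image.mp hz
    exact haE p
  · obtain ⟨p, hp, rfl⟩ := Finset.mem_image.mp hz
    exact mem_ball_zero_iff.mpr ((hP p).mp hp)
  rw [Finset.sum_image (injective_of_mem_squares hs ha).injOn]
  have hint := fun p : ℤ × ℤ => intervalIntegrable_indicator_inv (by positivity) hR ‖a p‖
  calc Real.pi / s ^ 2 * (R ^ 2 / 2 - 4 * s * R)
      ≤ Real.pi / s ^ 2 * ((R ^ 2 - (2 * s) ^ 2) / 2 - (R - 2 * s) * (4 * s)) := by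
        refine mul_le_mul_of_nonneg_left ?_ (by positivity)
        nlinarith
    _ = ∫ t in (2 * s)..R, Real.pi / s ^ 2 * (t - 4 * s) := by
        rw [intervalIntegral.integral_const_mul, intervalIntegral.integral_sub (by simp) (by simp),
          integral_id, intervalIntegral.integral_const, smul_eq_mul]
    _ ≤ ∫ t in (2 * s)..R, ∑ p ∈ P, (Set.Ici ‖a p‖).indicator (fun t => t⁻¹) t := by
        -- The comparison is made for `t < R` because `P` omits points of modulus exactly `R`. There
        -- the sum is `n(t) / t`, with `n` the counting function, and `(t - 2 s)² ≥ t (t - 4 s)`.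
        refine intervalIntegral.integral_mono_on_of_le_Ioo hR
          (Continuous.intervalIntegrable (by fun_prop) _ _) ?_ ?_
        · have := IntervalIntegrable.sum P fun p _ => hint p
          refine this.congr (fun t _ => ?_)
          simp
        intro t ht
        have ht0 : 0 < t := by linarith [ht.1]
        have hcard := pi_mul_sq_le_card_of_mem_squares (P := P) hs hs0 ha
          (fun p hp => (hP p).mpr (hp.trans_lt ht.2)) ht.1.le
        have hsum : ∑ p ∈ P, (Set.Ici ‖a p‖).indicator (fun t => t⁻¹) t =
            (P.filter fun p => ‖a p‖ ≤ t).card * t⁻¹ := by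
          rw [← nsmul_eq_mul, ← Finset.sum_const, Finset.sum_filter]
          refine Finset.sum_congr rfl fun p _ => ?_
          simp [Set.indicator_apply]
        rw [hsum, ← div_eq_mul_inv, le_div_iff₀ ht0, div_mul_eq_mul_div, div_mul_eq_mul_div,
          div_le_iff₀ (by positivity)]
        refine le_trans ?_ hcard
        rw [mul_assoc]
        gcongr
        nlinarith
    _ = ∑ p ∈ P, ∫ t in (2 * s)..R, (Set.Ici ‖a p‖).indicator (fun t => t⁻¹) t :=
        intervalIntegral.integral_finsetSum fun p _ => hint p
    _ ≤ ∑ p ∈ P, Real.log (R / ‖a p‖) := by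
        refine Finset.sum_le_sum fun p hp => ?_
        refine integral_indicator_inv_le_log hR (norm_pos_iff.mpr fun h => h0 ?_)
          ((hP p).mp hp).le
        exact h ▸ haE p

/-! ### Comparison of growth as `R` tends to infinity, and conclusion. -/

theorem norm_prod_canonicalFactor_zero {R : ℝ} (hR : 0 < R) {S : Finset ℂ} (hS : (0 : ℂ) ∉ S) :
    ‖∏ a ∈ S, canonicalFactor R a 0‖ = Real.exp (∑ a ∈ S, Real.log (R / ‖a‖)) := by
  rw [norm_prod, Real.exp_sum]
  refine Finset.prod_congr rfl fun a ha => ?_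
  have ha0 : 0 < ‖a‖ := norm_pos_iff.mpr fun h => hS (h ▸ ha)
  rw [Real.exp_log (by positivity), canonicalFactor_apply]
  simp only [mul_zero, sub_zero, zero_sub, norm_div, norm_pow, norm_mul, norm_neg, norm_real,
    Real.norm_of_nonneg hR.le]
  field_simp

/-- A bounded function whose logarithm has Laplacian bounded from below vanishes if its zero set is
sufficiently dense. -/
theorem IsLogSupported.apply_zero_eq_zero {K M A : ℝ} (hK : 0 < K) (hA0 : 0 ≤ A)
    (hA : A < Real.pi / (2 * K ^ 2)) {E : Set ℂ} (hE : IsKDense K E)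
    {d : ℂ → ℝ} (hd : Continuous d) (hd0 : ∀ z, 0 ≤ d z) (hdM : ∀ z, d z ≤ M)
    (hsupp : IsLogSupported A d) (hdE : ∀ a ∈ E, d =O[𝓝 a] fun z => z - a) : d 0 = 0 := by
  by_contra hne
  have hpos : 0 < d 0 := lt_of_le_of_ne (hd0 0) (Ne.symm hne)
  have h0 : (0 : ℂ) ∉ E := fun h => hne ((hdE 0 h).eq_zero_imp.self_of_nhds (sub_self 0))
  have hM : 0 < M := hpos.trans_le (hdM 0)
  -- `A₁ > A` gives the strict gain in the maximum principle; `B < π / (2 K²)` makes the spacing `s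
  -- = √(π / (2 B))` exceed `K`.
  obtain ⟨A₁, hA1, hA1'⟩ := exists_between hA
  obtain ⟨B, hB, hB'⟩ := exists_between hA1'
  have hBpos : 0 < B := by linarith
  set s := Real.sqrt (Real.pi / (2 * B)) with hs
  have hs2 : s ^ 2 = Real.pi / (2 * B) := Real.sq_sqrt (by positivity)
  have hsK : K < s := by
    refine Real.lt_sqrt_of_sq_lt ?_
    rw [lt_div_iff₀ (by positivity)] at hB' ⊢
    linarith
  have hs0 : 0 < s := hK.trans hsK
  have hsB : Real.pi / s ^ 2 = 2 * B := by
    rw [hs2]; field_simp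
  -- This `N` makes `N * B` exceed `(N + 1) * A₁`, so the zeros outweigh the Gaussian.
  obtain ⟨N, hN⟩ := exists_nat_gt (A₁ / (B - A₁))
  set κ := N * B - (N + 1) * A₁ with hκ
  have hκ0 : 0 < κ := by
    rw [div_lt_iff₀ (by linarith)] at hN
    rw [hκ]; linarith
  set C := N * (8 * B * s) with hC
  set T := (N + 1) * (Real.log M - Real.log (d 0)) with hT
  have key : ∀ R, 2 * s ≤ R → κ * R ^ 2 - C * R ≤ T := by
    intro R hR
    have hR0 : 0 < R := by linarith
    obtain ⟨S, hSE, hSR, hsum⟩ := hE.exists_finset_le_sum_log hK hsK h0 hR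
    have h1 := pow_mul_prod_canonicalFactor_le hR0 hA1 hd hd0 hdM hsupp hSR
      (fun a ha => hdE a (hSE a ha)) N
    rw [norm_prod_canonicalFactor_zero hR0 fun h => h0 (hSE 0 h)] at h1
    have h2 := Real.log_le_log (by positivity) h1
    rw [Real.log_mul (by positivity) (by positivity), Real.log_pow,
      Real.log_mul (by positivity) (by positivity), Real.log_exp,
      Real.log_mul (by positivity) (by positivity), Real.log_pow, Real.log_exp] at h2
    rw [hsB] at hsum
    have h3 := mul_le_mul_of_nonneg_left hsum (Nat.cast_nonneg (α := ℝ) N)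
    push_cast at h2
    rw [hκ, hC, hT]
    linarith
  -- Here `κ * R - C ≥ 1` and `R ≥ T + 1`, so `κ * R ^ 2 - C * R` exceeds `T`.
  set R := max (2 * s) (max ((C + 1) / κ) (T + 1)) with hRdef
  have h1 : 2 * s ≤ R := le_max_left _ _
  have h2 : (C + 1) / κ ≤ R := (le_max_left _ _).trans (le_max_right _ _)
  have h3 : T + 1 ≤ R := (le_max_right _ _).trans (le_max_right _ _)
  have h4 := key R h1
  rw [div_le_iff₀ hκ0] at h2
  nlinarith

theorem IsKDense.preimage_add {K : ℝ} {E : Set ℂ} (hE : IsKDense K E) (w : ℂ) :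
    IsKDense K ((fun z => z + w) ⁻¹' E) := by
  intro a u
  obtain ⟨z, ⟨x, hx, y, hy, rfl⟩, hz⟩ := hE (a + w) u
  refine ⟨a + u * (x + y * I), ⟨x, hx, y, hy, rfl⟩, ?_⟩
  rw [Set.mem_preimage]
  convert hz using 1
  ring

theorem IsLogSupported.comp_add {A : ℝ} {d : ℂ → ℝ} (hd : IsLogSupported A d) (w : ℂ) :
    IsLogSupported A fun z => d (z + w) := by
  intro z₀ hz₀
  obtain ⟨h, hh, heq, hle⟩ := hd (z₀ + w) hz₀
  have hcont : Tendsto (fun z => z + w) (𝓝 z₀) (𝓝 (z₀ + w)) :=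
    (continuous_add_const w).tendsto z₀
  refine ⟨fun z => h (z + w), ?_, heq, ?_⟩
  · exact AnalyticAt.fun_comp hh (by fun_prop)
  · filter_upwards [hcont.eventually hle] with z hz
    simpa using hz

theorem IsLogSupported.eq_zero {K M A : ℝ} (hK : 0 < K) (hA0 : 0 ≤ A)
    (hA : A < Real.pi / (2 * K ^ 2)) {E : Set ℂ} (hE : IsKDense K E)
    {d : ℂ → ℝ} (hd : Continuous d) (hd0 : ∀ z, 0 ≤ d z) (hdM : ∀ z, d z ≤ M)
    (hsupp : IsLogSupported A d) (hdE : ∀ a ∈ E, d =O[𝓝 a] fun z => z - a) (w : ℂ) : d w = 0 := by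
  have h := (hsupp.comp_add w).apply_zero_eq_zero hK hA0 hA (hE.preimage_add w)
    (hd.comp (continuous_add_const w)) (fun z => hd0 _) (fun z => hdM _) fun a ha => by
      have := (hdE (a + w) ha).comp_tendsto ((continuous_add_const w).tendsto a)
      simpa [Function.comp_def] using this
  simpa using h

theorem repSphericalDeriv_nonneg {n : ℕ} (F : ℂ → EuclideanSpace ℂ (Fin (n + 1))) (z : ℂ) :
    0 ≤ repSphericalDeriv F z := by
  unfold repSphericalDeriv; positivity

theorem sphericalDeriv_nonneg {n : ℕ} (f : ℂ → CPn n) (z : ℂ) : 0 ≤ sphericalDeriv f z := by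
  unfold sphericalDeriv
  split_ifs
  · exact repSphericalDeriv_nonneg _ _
  · exact le_rfl

theorem sphericalDeriv_le_of_mem_normalCurvesBound {n : ℕ} {L : ℝ} {f : ℂ → CPn n}
    (hf : f ∈ normalCurvesBound n L) (z : ℂ) : sphericalDeriv f z ≤ L :=
  (le_ciSup hf.1.2 z).trans hf.2

theorem theorem5 (n : ℕ) (K c : ℝ) (hK : 0 < K) (hc : c < Real.sqrt (Real.pi / 2))
    (E : Set ℂ) (hE : IsKDense K E) (f₀ f₁ : ℂ → CPn n)
    (hf₀ : f₀ ∈ normalCurvesBound n (c / K)) (hf₁ : f₁ ∈ normalCurvesBound n (c / K))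
    (h : Set.EqOn f₀ f₁ E) : f₀ = f₁ := by
  have hL0 : 0 ≤ c / K :=
    (sphericalDeriv_nonneg f₀ 0).trans (sphericalDeriv_le_of_mem_normalCurvesBound hf₀ 0)
  have hc0 : 0 ≤ c := by
    have := mul_nonneg hL0 hK.le
    rwa [div_mul_cancel₀ _ hK.ne'] at this
  have hc2 : c ^ 2 < Real.pi / 2 := (Real.lt_sqrt hc0).mp hc
  have hlt : (c / K) ^ 2 < Real.pi / (2 * K ^ 2) := by
    rw [div_pow, ← div_div]
    gcongr
  -- The lift estimate needs the squared spherical derivatives strictly below `A`.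
  obtain ⟨A, hA, hA'⟩ := exists_between hlt
  have hbound : ∀ f ∈ normalCurvesBound n (c / K), ∀ z, sphericalDeriv f z ^ 2 < A :=
    fun f hf z => lt_of_le_of_lt (pow_le_pow_left₀ (sphericalDeriv_nonneg f z)
      (sphericalDeriv_le_of_mem_normalCurvesBound hf z) 2) hA
  funext w
  refine eq_of_normalizedMinor_eq_zero fun i j => ?_
  exact (isLogSupported_normalizedMinor hf₀.1.1 hf₁.1.1 (hbound f₀ hf₀) (hbound f₁ hf₁)).eq_zero
    hK ((sq_nonneg _).trans hA.le) hA' hE (continuous_normalizedMinor hf₀.1.1 hf₁.1.1)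
    (fun _ => normalizedMinor_nonneg _ _) (fun _ => normalizedMinor_le _ _)
    (fun a ha => isBigO_normalizedMinor hf₀.1.1 hf₁.1.1 (h ha)) w
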